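/- For a group $G$ and a positive integer $r$ let $s_r(G)$ denote the number of subgroups of $G$ of index at most $r$, and let $C_m$ denote the cyclic group of order $m$. All logarithms are natural. Let $d$ and $R$ be fixed positive real numbers and put $$\gamma=\frac{\left(\sqrt{R(R+1)}-R\right)^2}{4R^2}.$$ Then for every $\varepsilon>0$ there is $N=N(d,R,\varepsilon)$ such that the following holds. Let $n,r\ge N$ be positive integers and let $A=C_{x_1}\times C_{x_2}\times\cdots\times C_{x_t}$ be a finite abelian group in which every positive integer occurs at most $d$ times among the orders $x_1,\dots,x_t\geq 1$ of the cyclic factors. If $r|A|^R\le n$, then $$s_r(A)\le n^{(\gamma+\varepsilon)\frac{\log n}{\log\log n}}.$$ In other words, $s_r(A)\le n^{(\gamma+o(1))\log n/\log\log n}$ as $n,r\to\infty$, where for fixed $d$ and $R$ the $o(1)$ term is uniform in $A$. -/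

import Mathlib

/-- The abelian group `C_{x_1} × ⋯ × C_{x_t}`, where `C_m` is the cyclic group of order `m`
(for `m ≥ 1`), written multiplicatively. -/
abbrev CyclicProduct {t : ℕ} (x : Fin t → ℕ) : Type :=
  (i : Fin t) → Multiplicative (ZMod (x i))

/-- `s_r(G)`: the number of subgroups of `G` of index at most `r`. Mathlib's `Subgroup.index` is `0`
for a subgroup of infinite index, so such subgroups are excluded explicitly. -/
noncomputable def subgroupCount (G : Type*) [Group G] (r : ℕ) : ℕ :=
  Set.ncard {H : Subgroup G | H.index ≠ 0 ∧ H.index ≤ r}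

/-- The constant `γ = (√(R(R+1)) - R)² / (4R²)`. -/
noncomputable def gammaConst (R : ℝ) : ℝ :=
  (Real.sqrt (R * (R + 1)) - R) ^ 2 / (4 * R ^ 2)

/-! Rankin's trick gives `s_r(A) ≤ r ^ z * ζ(z)`, where `ζ(z)` sums `[A : H] ^ (-z)` over subgroups;
here `z = 4Rγt`, proportional to the number `t` of factors. To bound `ζ`, one prime is stripped at a
time: `A` maps onto the product of the `C_{x_i / (x_i, p)}` with kernel the `p`-torsion, of rank `f`
say, and the subgroups with a given image correspond to certain subgroups of an elementary abelian
group of order `p ^ f` (`subgroupZeta_le_of_surjective`). If `f ≤ z` this costs only `p ^ (2f)`;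
otherwise it costs a further `p ^ (zRf)`, and `p` is put into `Q`. Hence `Q ^ z ≤ |A|` and `ζ(z) ≤
|A| ^ 2 * D ^ (zR)` with `D = ∏ (x_i, Q)`.

Put `L = log n`, `l = log L` and `Y = |A| / D`. Since `log r + R log |A| ≤ L`, this yields `log s_r
≤ 4Rγt (L - R log Y) + (2/R) L`. For `t` not too small, `Q` is at most a power of `L`, so it has few
divisors, and bounded multiplicity forces most `x_i / (x_i, Q)` above `L ^ (1 - η)`
(`le_log_prod_div_gcd`). Thus `log Y` is at least nearly `t l`, and maximizing `4Rγt (L - Rtl)` over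
`t` gives `γ L² / l`. -/

/-! ### Subgroups of elementary abelian groups. -/

open Module in
/-- The number of `k`-dimensional subspaces, weighted by a lower bound for the number of bases of
each, is at most the number of `k`-tuples. -/
lemma card_submodule_finrank_mul_le {K V : Type*} [Field K] [Finite K] [AddCommGroup V]
    [Module K V] [Finite V] (k : ℕ) :
    Nat.card {W : Submodule K V // finrank K W = k} * Nat.card K ^ (k * (k - 1)) ≤
      Nat.card V ^ k := by
  classical
  let := Fintype.ofFinite K
  have hbases : ∀ W : {W : Submodule K V // finrank K W = k},
      Nat.card K ^ (k * (k - 1)) ≤ Nat.card {s : Fin k → W.1 // LinearIndependent K s} := by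
    rintro ⟨W, hW⟩
    rw [card_linearIndependent hW.ge, hW, Nat.card_eq_fintype_card]
    calc Fintype.card K ^ (k * (k - 1)) = ∏ _i : Fin k, Fintype.card K ^ (k - 1) := by
          simp [pow_mul, pow_right_comm]
      _ ≤ _ := by
          -- Each factor `q ^ k - q ^ i` of the basis count is at least `q ^ (k - 1)`, because `i ≤
          -- k - 1` and `q ≥ 2`.
          refine Finset.prod_le_prod' fun i _ => ?_
          have hq : 1 < Fintype.card K := Fintype.one_lt_card
          have hi : i.1 ≤ k - 1 := by omega
          have h1 : Fintype.card K ^ i.1 ≤ Fintype.card K ^ (k - 1) :=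
            Nat.pow_le_pow_right hq.le hi
          have h2 : Fintype.card K ^ k = Fintype.card K ^ (k - 1) * Fintype.card K := by
            rw [← pow_succ]; congr 1; omega
          have h3 : Fintype.card K ^ (k - 1) * 2 ≤ Fintype.card K ^ (k - 1) * Fintype.card K :=
            Nat.mul_le_mul_left _ hq
          omega
  let := Fintype.ofFinite {W : Submodule K V // finrank K W = k}
  calc Nat.card {W : Submodule K V // finrank K W = k} * Nat.card K ^ (k * (k - 1))
      = ∑ _W : {W : Submodule K V // finrank K W = k}, Nat.card K ^ (k * (k - 1)) := by
        simp [Nat.card_eq_fintype_card]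
    _ ≤ ∑ W : {W : Submodule K V // finrank K W = k},
          Nat.card {s : Fin k → W.1 // LinearIndependent K s} :=
        Finset.sum_le_sum fun W _ => hbases W
    _ = Nat.card (Σ W : {W : Submodule K V // finrank K W = k},
          {s : Fin k → W.1 // LinearIndependent K s}) := Nat.card_sigma.symm
    _ ≤ Nat.card (Fin k → V) := by
        refine Nat.card_le_card_of_injective (fun x i => (x.2.1 i : V)) ?_
        have hspan : ∀ x : (Σ W : {W : Submodule K V // finrank K W = k},
            {s : Fin k → W.1 // LinearIndependent K s}),
            Submodule.span K (Set.range fun i => (x.2.1 i : V)) = x.1.1 := by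
          rintro ⟨⟨W, hW⟩, s, hs⟩
          have htop := hs.span_eq_top_of_card_eq_finrank' (by simp [hW])
          have := congrArg (Submodule.map W.subtype) htop
          rw [Submodule.map_span, ← Set.range_comp] at this
          simpa [Function.comp_def] using this
        rintro ⟨⟨W, hW⟩, s, hs⟩ ⟨⟨W', hW'⟩, s', hs'⟩ hxy
        have h1 := hspan ⟨⟨W, hW⟩, s, hs⟩
        have h2 := hspan ⟨⟨W', hW'⟩, s', hs'⟩
        simp only at h1 h2 hxy
        rw [hxy, h2] at h1
        subst h1
        congr
        funext i
        exact Subtype.ext (congrFun hxy i)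
    _ = Nat.card V ^ k := by simp [Nat.card_fun]

lemma card_addSubgroup_le_of_module {U : Type*} [AddCommGroup U] [Finite U] {p f k : ℕ}
    [Fact p.Prime] [Module (ZMod p) U] (hcard : Nat.card U = p ^ f) (hk : k ≤ f) :
    Nat.card {W : AddSubgroup U // Nat.card W = p ^ k} ≤ p ^ (k * (f - k) + k) := by
  have hp : p.Prime := Fact.out
  have h1 := card_submodule_finrank_mul_le (K := ZMod p) (V := U) k
  have h2 : Nat.card {W : AddSubgroup U // Nat.card W = p ^ k} ≤
      Nat.card {W : Submodule (ZMod p) U // Module.finrank (ZMod p) W = k} := by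
    refine Nat.card_le_card_of_injective
      (fun W => ⟨AddSubgroup.toZModSubmodule p W.1, ?_⟩) ?_
    · have hW : Nat.card (AddSubgroup.toZModSubmodule p W.1) = p ^ k := W.2
      rw [Module.natCard_eq_pow_finrank (K := ZMod p), Nat.card_zmod] at hW
      exact Nat.pow_right_injective hp.two_le hW
    · intro W W' h
      exact Subtype.ext ((AddSubgroup.toZModSubmodule p).injective (congrArg Subtype.val h))
  rw [hcard, Nat.card_zmod, ← pow_mul] at h1
  have h4 : p ^ (f * k) = p ^ (k * (f - k) + k) * p ^ (k * (k - 1)) := by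
    rw [← pow_add]
    congr 1
    obtain ⟨m, rfl⟩ := Nat.exists_eq_add_of_le hk
    rcases k with _ | k
    · simp
    · simp only [Nat.add_sub_cancel_left, Nat.add_sub_cancel]; ring
  rw [h4] at h1
  exact h2.trans (Nat.le_of_mul_le_mul_right h1 (pow_pos hp.pos _))

/-- An elementary abelian `p`-group of order `p ^ f` has at most `p ^ (k * (f - k) + k)` subgroups
of order `p ^ k`. -/
lemma card_subgroup_elementary_le {V : Type*} [CommGroup V] [Finite V] {p f k : ℕ}
    (hp : p.Prime) (hexp : ∀ v : V, v ^ p = 1) (hcard : Nat.card V = p ^ f) (hk : k ≤ f) :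
    Nat.card {W : Subgroup V // Nat.card W = p ^ k} ≤ p ^ (k * (f - k) + k) := by
  have : Fact p.Prime := ⟨hp⟩
  let : Module (ZMod p) (Additive V) := AddCommGroup.zmodModule hexp
  refine le_trans (Nat.card_le_card_of_injective
    (fun W => ⟨Subgroup.toAddSubgroup W.1, W.2⟩) fun W W' h => ?_)
    (card_addSubgroup_le_of_module (U := Additive V) hcard hk)
  exact Subtype.ext (Subgroup.toAddSubgroup.injective (congrArg Subtype.val h))

/-! ### The subgroup zeta sum and the removal of one prime. -/

/-- The sum of `[G : H] ^ (-z)` over all subgroups `H` of the finite group `G`. -/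
noncomputable def subgroupZeta (G : Type*) [Group G] [Finite G] (z : ℝ) : ℝ :=
  let := Fintype.ofFinite (Subgroup G)
  ∑ H : Subgroup G, (H.index : ℝ) ^ (-z)

/-- Rankin's trick: each subgroup counted has `(r / [G : H]) ^ z ≥ 1`. -/
lemma subgroupCount_le_rpow_mul_subgroupZeta (G : Type*) [Group G] [Finite G] {z : ℝ}
    (hz : 0 ≤ z) (r : ℕ) : (subgroupCount G r : ℝ) ≤ (r : ℝ) ^ z * subgroupZeta G z := by
  classical
  let := Fintype.ofFinite (Subgroup G)
  unfold subgroupCount subgroupZeta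
  rw [Set.ncard_eq_toFinset_card', Finset.cast_card, Finset.mul_sum]
  refine le_trans (Finset.sum_le_sum fun H hH => ?_)
    (Finset.sum_le_sum_of_subset_of_nonneg (Finset.subset_univ _) fun H _ _ => by positivity)
  simp only [Set.mem_toFinset, Set.mem_ofPred_eq] at hH
  have h0 : (0 : ℝ) < H.index := by exact_mod_cast Nat.pos_of_ne_zero hH.1
  have h1 : (H.index : ℝ) ≤ r := by exact_mod_cast hH.2
  rw [Real.rpow_neg h0.le, ← div_eq_mul_inv, one_le_div (by positivity)]
  exact Real.rpow_le_rpow h0.le h1 hz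

/-- Index `p ^ ν` contributes at most `p ^ (ν(f - ν) - zν + (f - ν))`, hence at most `p ^ (e + f)`.
The other `p ^ f` pays for the `f + 1` values of `ν`. -/
lemma subgroupZeta_elementary_le {V : Type*} [CommGroup V] [Finite V] {p f : ℕ}
    (hp : p.Prime) (hexp : ∀ v : V, v ^ p = 1) (hcard : Nat.card V = p ^ f) {z e : ℝ}
    (he : ∀ ν : ℕ, ν ≤ f → (ν : ℝ) * (f - ν) ≤ z * ν + e) :
    subgroupZeta V z ≤ (p : ℝ) ^ (2 * f) * (p : ℝ) ^ e := by
  classical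
  let := Fintype.ofFinite (Subgroup V)
  unfold subgroupZeta
  have hp0 : (0 : ℝ) < p := by exact_mod_cast hp.pos
  have hp1 : (1 : ℝ) ≤ p := by exact_mod_cast hp.one_lt.le
  have hlog : ∀ W : Subgroup V, ∃ k ≤ f, Nat.card W = p ^ k := fun W =>
    (Nat.dvd_prime_pow hp).1 (hcard ▸ Subgroup.card_subgroup_dvd_card W)
  choose κ hκf hκ using hlog
  have hindex : ∀ W : Subgroup V, W.index = p ^ (f - κ W) := fun W => by
    have h := W.card_mul_index
    rw [hκ, hcard, ← Nat.add_sub_cancel' (hκf W), pow_add] at h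
    exact Nat.eq_of_mul_eq_mul_left (pow_pos hp.pos _) h
  have hmaps : ∀ W ∈ (Finset.univ : Finset (Subgroup V)), κ W ∈ Finset.range (f + 1) :=
    fun W _ => Finset.mem_range.2 (Nat.lt_succ_of_le (hκf W))
  rw [← Finset.sum_fiberwise_of_maps_to hmaps]
  have hfib : ∀ k ∈ Finset.range (f + 1),
      ∑ W with κ W = k, (W.index : ℝ) ^ (-z) ≤ (p : ℝ) ^ f * (p : ℝ) ^ e := by
    intro k hk
    have hkf : k ≤ f := Nat.lt_succ_iff.1 (Finset.mem_range.1 hk)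
    have hcount : (Finset.univ.filter fun W : Subgroup V => κ W = k).card ≤
        p ^ (k * (f - k) + k) := by
      refine le_trans (le_of_eq ?_) (card_subgroup_elementary_le hp hexp hcard hkf)
      rw [Nat.card_eq_fintype_card, Fintype.card_subtype]
      congr 1
      ext W
      simp [hκ W, Nat.pow_right_inj hp.two_le]
    calc ∑ W with κ W = k, (W.index : ℝ) ^ (-z)
        = ∑ W : Subgroup V with κ W = k, ((p : ℝ) ^ (f - k)) ^ (-z) :=
          Finset.sum_congr rfl fun W hW => by
            rw [hindex W, (Finset.mem_filter.1 hW).2]; push_cast; rfl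
      _ ≤ (p : ℝ) ^ (k * (f - k) + k) * ((p : ℝ) ^ (f - k)) ^ (-z) := by
          rw [Finset.sum_const, nsmul_eq_mul]
          exact mul_le_mul_of_nonneg_right (by exact_mod_cast hcount) (by positivity)
      _ ≤ (p : ℝ) ^ f * (p : ℝ) ^ e := by
          rw [← Real.rpow_natCast, ← Real.rpow_natCast, ← Real.rpow_natCast,
            ← Real.rpow_mul hp0.le, ← Real.rpow_add hp0, ← Real.rpow_add hp0]
          refine Real.rpow_le_rpow_of_exponent_le hp1 ?_
          have h := he (f - k) (Nat.sub_le _ _)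
          have hkf' : (k : ℝ) ≤ f := by exact_mod_cast hkf
          push_cast [Nat.cast_sub hkf] at h ⊢
          nlinarith
  refine (Finset.sum_le_card_nsmul _ _ _ hfib).trans ?_
  rw [Finset.card_range, nsmul_eq_mul, ← mul_assoc]
  refine mul_le_mul_of_nonneg_right ?_ (by positivity)
  rw [two_mul, pow_add]
  refine mul_le_mul_of_nonneg_right ?_ (by positivity)
  have : f + 1 ≤ p ^ f := Nat.lt_pow_self hp.one_lt
  exact_mod_cast this

/-- Comparison of `subgroupZeta` along a surjection whose kernel is the `p`-torsion. The subgroups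
`H` with a given image lie between `P` and `P ^ p`, where `P` is the preimage of that image, and
`P / P ^ p` is elementary abelian. -/
lemma subgroupZeta_le_of_surjective {G G' : Type*} [CommGroup G] [CommGroup G'] [Finite G]
    [Finite G'] {p f : ℕ} (hp : p.Prime) (φ : G →* G') (hφ : Function.Surjective φ)
    (hker : ∀ g, φ g = 1 ↔ g ^ p = 1) (hcard : Nat.card G = p ^ f * Nat.card G') {z e : ℝ}
    (he : ∀ ν : ℕ, ν ≤ f → (ν : ℝ) * (f - ν) ≤ z * ν + e) :
    subgroupZeta G z ≤ subgroupZeta G' z * ((p : ℝ) ^ (2 * f) * (p : ℝ) ^ e) := by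
  classical
  have hkereq : φ.ker = (powMonoidHom p : G →* G).ker := by
    ext g; simp [MonoidHom.mem_ker, hker]
  have hkercard : Nat.card φ.ker = p ^ f := by
    have h := φ.ker.card_mul_index
    rw [Subgroup.index_ker, MonoidHom.range_eq_top.2 hφ, Subgroup.card_top, hcard] at h
    exact Nat.eq_of_mul_eq_mul_right Nat.card_pos h
  have hfib : ∀ M : Subgroup G', ∀ s : Finset (Subgroup G), (∀ H ∈ s, H.map φ = M) →
      ∑ H ∈ s, (H.index : ℝ) ^ (-z) ≤
        (M.index : ℝ) ^ (-z) * ((p : ℝ) ^ (2 * f) * (p : ℝ) ^ e) := by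
    intro M s hs
    set P := M.comap φ with hP
    set N := (P.map (powMonoidHom p)).subgroupOf P with hN
    have hkerP : φ.ker ≤ P := fun g hg => by
      rw [hP, Subgroup.mem_comap, MonoidHom.mem_ker.1 hg]; exact M.one_mem
    have hpowP : P.map (powMonoidHom p) ≤ P := by
      rintro _ ⟨g, hg, rfl⟩
      exact P.pow_mem hg p
    have hexp : ∀ v : P ⧸ N, v ^ p = 1 := by
      intro v
      obtain ⟨g, rfl⟩ := QuotientGroup.mk_surjective v
      rw [← QuotientGroup.mk_pow, QuotientGroup.eq_one_iff, hN, Subgroup.mem_subgroupOf]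
      exact ⟨g, g.2, rfl⟩
    -- `P` contains all the `p`-torsion, so the kernel of the `p`-th power map on `P` is `φ.ker`.
    have hV : Nat.card (P ⧸ N) = p ^ f := by
      have h1 : Nat.card (P.map (powMonoidHom p)) * p ^ f = Nat.card P := by
        rw [← Subgroup.relIndex_ker, ← hkereq, ← hkercard, mul_comm,
          ← Subgroup.relIndex_bot_left, ← Subgroup.relIndex_bot_left]
        exact Subgroup.relIndex_mul_relIndex _ _ _ bot_le hkerP
      have h2 : Nat.card N = Nat.card (P.map (powMonoidHom p)) :=
        Nat.card_congr (Subgroup.subgroupOfEquivOfLe hpowP).toEquiv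
      have h3 := N.card_eq_card_quotient_mul_card_subgroup
      rw [h2, ← h1, mul_comm] at h3
      exact (Nat.eq_of_mul_eq_mul_right Nat.card_pos h3).symm
    have hHP : ∀ H ∈ s, H ≤ P := fun H hH => Subgroup.map_le_iff_le_comap.1 (hs H hH).le
    -- Each `a ∈ P` differs from some `b ∈ H` by an element of `φ.ker`, which is `p`-torsion, so `a
    -- ^ p = b ^ p ∈ H`.
    have hNH : ∀ H ∈ s, N ≤ H.subgroupOf P := by
      intro H hH
      rintro ⟨g, hgP⟩ hg
      obtain ⟨a, ha, hag⟩ := Subgroup.mem_subgroupOf.1 hg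
      obtain ⟨b, hb, hab⟩ : φ a ∈ H.map φ := by rw [hs H hH]; exact ha
      have hker' : (a * b⁻¹) ^ p = 1 := (hker _).1 (by rw [map_mul, map_inv, hab, mul_inv_cancel])
      rw [mul_pow, inv_pow, mul_inv_eq_one] at hker'
      rw [Subgroup.mem_subgroupOf, ← hag]
      change a ^ p ∈ H
      rw [hker']
      exact H.pow_mem hb p
    let := Fintype.ofFinite (Subgroup (P ⧸ N))
    let W : Subgroup G → Subgroup (P ⧸ N) := fun H => (H.subgroupOf P).map (QuotientGroup.mk' N)
    have hWinj : Set.InjOn W s := by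
      intro H hH H' hH' h
      have h' := congrArg (Subgroup.comap (QuotientGroup.mk' N)) h
      simp only [W, QuotientGroup.comap_map_mk', sup_eq_right.2 (hNH H hH),
        sup_eq_right.2 (hNH H' hH')] at h'
      rw [Subgroup.subgroupOf_inj, inf_eq_left.2 (hHP H hH), inf_eq_left.2 (hHP H' hH')] at h'
      exact h'
    have hWindex : ∀ H ∈ s, H.index = M.index * (W H).index := by
      intro H hH
      have hPM : P.index = M.index := Subgroup.index_comap_of_surjective _ hφ
      rw [← Subgroup.relIndex_mul_index (hHP H hH), mul_comm, hPM,
        Subgroup.index_map_eq _ (QuotientGroup.mk'_surjective N)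
          (by rw [QuotientGroup.ker_mk']; exact hNH H hH)]
      rfl
    calc ∑ H ∈ s, (H.index : ℝ) ^ (-z)
        = (M.index : ℝ) ^ (-z) * ∑ H ∈ s, ((W H).index : ℝ) ^ (-z) := by
          rw [Finset.mul_sum]
          refine Finset.sum_congr rfl fun H hH => ?_
          rw [hWindex H hH, Nat.cast_mul, Real.mul_rpow (by positivity) (by positivity)]
      _ ≤ (M.index : ℝ) ^ (-z) * subgroupZeta (P ⧸ N) z := by
          refine mul_le_mul_of_nonneg_left ?_ (by positivity)
          rw [← Finset.sum_image (f := fun U : Subgroup (P ⧸ N) => (U.index : ℝ) ^ (-z)) hWinj]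
          exact Finset.sum_le_sum_of_subset_of_nonneg (Finset.subset_univ _)
            fun U _ _ => by positivity
      _ ≤ _ := mul_le_mul_of_nonneg_left (subgroupZeta_elementary_le hp hexp hV he)
          (by positivity)
  let := Fintype.ofFinite (Subgroup G)
  let := Fintype.ofFinite (Subgroup G')
  unfold subgroupZeta
  rw [← Finset.sum_fiberwise (s := Finset.univ) (g := fun H : Subgroup G => H.map φ),
    Finset.sum_mul]
  exact Finset.sum_le_sum fun M _ => hfib M _ fun H hH => (Finset.mem_filter.1 hH).2

/-! ### Products of cyclic groups: stripping all primes. -/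

lemma card_cyclicProduct {t : ℕ} (x : Fin t → ℕ) : Nat.card (CyclicProduct x) = ∏ i, x i := by
  rw [Nat.card_pi]
  exact Finset.prod_congr rfl fun i _ => Nat.card_zmod (x i)

lemma finite_cyclicProduct {t : ℕ} {x : Fin t → ℕ} (hx : ∀ i, 0 < x i) :
    Finite (CyclicProduct x) :=
  Nat.finite_of_card_ne_zero
    (by rw [card_cyclicProduct]; exact Finset.prod_ne_zero_iff.2 fun i _ => (hx i).ne')

/-- The `p`-th multiple of `a : ZMod m` vanishes iff the reduction of `a` modulo `m / (m, p)`
does. -/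
lemma ZMod.cast_div_gcd_eq_zero_iff {m : ℕ} (hm : 0 < m) (p : ℕ) (a : ZMod m) :
    ZMod.castHom (Nat.div_dvd_of_dvd (Nat.gcd_dvd_left m p)) (ZMod (m / m.gcd p)) a = 0 ↔
      p • a = 0 := by
  have : NeZero m := ⟨hm.ne'⟩
  obtain ⟨k, rfl⟩ := ZMod.natCast_zmod_surjective a
  rw [map_natCast, nsmul_eq_mul, ← Nat.cast_mul, ZMod.natCast_eq_zero_iff,
    ZMod.natCast_eq_zero_iff]
  have hg : 0 < m.gcd p := Nat.gcd_pos_of_pos_left _ hm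
  constructor
  · intro h
    calc m = m.gcd p * (m / m.gcd p) := (Nat.mul_div_cancel' (Nat.gcd_dvd_left _ _)).symm
      _ ∣ p * k := mul_dvd_mul (Nat.gcd_dvd_right _ _) h
  · intro h
    refine (Nat.coprime_div_gcd_div_gcd hg).dvd_of_dvd_mul_left (m := p / m.gcd p) ?_
    refine Nat.dvd_of_mul_dvd_mul_left hg ?_
    rwa [← mul_assoc, Nat.mul_div_cancel' (Nat.gcd_dvd_left _ _),
      Nat.mul_div_cancel' (Nat.gcd_dvd_right _ _)]

/-- Reduction of each cyclic factor `C_{x_i}` to `C_{x_i / (x_i, p)}`. -/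
def reduceCyclicProduct {t : ℕ} (x : Fin t → ℕ) (p : ℕ) :
    CyclicProduct x →* CyclicProduct fun i => x i / (x i).gcd p :=
  MonoidHom.pi fun i =>
    (AddMonoidHom.toMultiplicative
      (ZMod.castHom (Nat.div_dvd_of_dvd (Nat.gcd_dvd_left (x i) p))
        (ZMod (x i / (x i).gcd p))).toAddMonoidHom).comp (Pi.evalMonoidHom _ i)

lemma reduceCyclicProduct_surjective {t : ℕ} (x : Fin t → ℕ) (p : ℕ) :
    Function.Surjective (reduceCyclicProduct x p) := by
  intro g
  choose a ha using fun i => ZMod.castHom_surjective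
    (Nat.div_dvd_of_dvd (Nat.gcd_dvd_left (x i) p)) (g i).toAdd
  exact ⟨fun i => Multiplicative.ofAdd (a i), funext fun i => congrArg Multiplicative.ofAdd (ha i)⟩

lemma reduceCyclicProduct_eq_one_iff {t : ℕ} {x : Fin t → ℕ} (hx : ∀ i, 0 < x i) (p : ℕ)
    (g : CyclicProduct x) : reduceCyclicProduct x p g = 1 ↔ g ^ p = 1 := by
  rw [funext_iff, funext_iff]
  exact forall_congr' fun i => ZMod.cast_div_gcd_eq_zero_iff (hx i) p (g i).toAdd

lemma prod_gcd_prime {t : ℕ} (x : Fin t → ℕ) {p : ℕ} (hp : p.Prime) :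
    ∏ i, (x i).gcd p = p ^ (Finset.univ.filter fun i => p ∣ x i).card := by
  rw [← Finset.prod_const, Finset.prod_filter]
  refine Finset.prod_congr rfl fun i _ => ?_
  split_ifs with h
  · exact Nat.gcd_eq_right h
  · exact ((Nat.Prime.coprime_iff_not_dvd hp).2 h).symm

/-- Bound for `subgroupZeta` of a product of cyclic groups in terms of the common part of the
orders with a single integer `Q`, which collects the primes dividing more than `z` of the orders. -/
theorem exists_subgroupZeta_cyclicProduct_le {t : ℕ} {z w : ℝ} (hw : 0 ≤ w)
    (hzw : ∀ f ν : ℕ, f ≤ t → ν ≤ f → (ν : ℝ) * (f - ν) ≤ z * ν + w * f)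
    (x : Fin t → ℕ) (hx : ∀ i, 0 < x i) [Finite (CyclicProduct x)] :
    ∃ Q : ℕ, 0 < Q ∧ (Q : ℝ) ^ z ≤ ((∏ i, x i : ℕ) : ℝ) ∧
      subgroupZeta (CyclicProduct x) z ≤
        ((∏ i, x i : ℕ) : ℝ) ^ 2 * ((∏ i, (x i).gcd Q : ℕ) : ℝ) ^ w := by
  classical
  induction hn : ∏ i, x i using Nat.strong_induction_on generalizing x with
  | _ n ih =>
  by_cases h1 : ∀ i, x i = 1
  · have hcard : Nat.card (CyclicProduct x) = 1 := by simp [card_cyclicProduct, h1]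
    have hn1 : n = 1 := by rw [← hn]; simp [h1]
    refine ⟨1, one_pos, by simp [hn1], ?_⟩
    have := (Nat.card_eq_one_iff_unique.1 hcard).1
    let := Fintype.ofFinite (Subgroup (CyclicProduct x))
    have hsum : subgroupZeta (CyclicProduct x) z = 1 := by
      unfold subgroupZeta
      rw [Fintype.sum_eq_single ⊤ fun H hH => (hH (Subsingleton.elim _ _)).elim]
      simp
    simp [hsum, hn1]
  · push Not at h1
    obtain ⟨j, hj⟩ := h1
    obtain ⟨p, hp, hpj⟩ := Nat.exists_prime_and_dvd hj
    set x' : Fin t → ℕ := fun i => x i / (x i).gcd p with hx'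
    have hxx' : ∀ i, x i = (x i).gcd p * x' i := fun i =>
      (Nat.mul_div_cancel' (Nat.gcd_dvd_left _ _)).symm
    have hx'pos : ∀ i, 0 < x' i := fun i => Nat.div_gcd_pos_of_pos_left _ (hx i)
    set f := (Finset.univ.filter fun i => p ∣ x i).card with hf
    have hft : f ≤ t := by simpa using Finset.card_filter_le Finset.univ fun i => p ∣ x i
    have hf0 : f ≠ 0 := Finset.card_ne_zero_of_mem (a := j) (by simp [hpj])
    have hprod : n = p ^ f * ∏ i, x' i := by
      rw [← hn, hf, ← prod_gcd_prime x hp, ← Finset.prod_mul_distrib]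
      exact Finset.prod_congr rfl fun i _ => hxx' i
    have hprod0 : 0 < ∏ i, x' i := Finset.prod_pos fun i _ => hx'pos i
    have hlt : ∏ i, x' i < n := by
      rw [hprod]
      exact lt_mul_of_one_lt_left hprod0 (Nat.one_lt_pow hf0 hp.one_lt)
    have := finite_cyclicProduct hx'pos
    obtain ⟨Q, hQ0, hQ, hZ⟩ := ih _ hlt x' hx'pos rfl
    have hstep := fun {e : ℝ} => subgroupZeta_le_of_surjective (e := e) (z := z) (f := f) hp
      (reduceCyclicProduct x p) (reduceCyclicProduct_surjective x p)
      (reduceCyclicProduct_eq_one_iff hx p)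
      (by rw [card_cyclicProduct, card_cyclicProduct, hn, hprod])
    have hp0 : (0 : ℝ) < p := by exact_mod_cast hp.pos
    have hp1 : (1 : ℝ) ≤ p := by exact_mod_cast hp.one_lt.le
    -- For `f ≤ z` the maximum of `ν(f - ν) - zν` is `0`, so `e = 0` works and `Q` is kept. For `f >
    -- z`, `p ^ z ≤ p ^ f` lets `Q` absorb `p`.
    by_cases hfz : (f : ℝ) ≤ z
    · refine ⟨Q, hQ0, hQ.trans (by exact_mod_cast hlt.le), ?_⟩
      refine (hstep (e := 0) fun ν _ => ?_).trans ?_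
      · nlinarith [Nat.cast_nonneg (α := ℝ) ν]
      · rw [Real.rpow_zero, mul_one]
        refine (mul_le_mul_of_nonneg_right hZ (by positivity)).trans ?_
        rw [hprod]
        have hg : ∏ i, (x' i).gcd Q ≤ ∏ i, (x i).gcd Q := Finset.prod_le_prod' fun i _ =>
          Nat.le_of_dvd (Nat.gcd_pos_of_pos_right _ hQ0)
            (Nat.gcd_dvd_gcd_of_dvd_left _ (hxx' i ▸ dvd_mul_left _ _))
        have hg' : ((∏ i, (x' i).gcd Q : ℕ) : ℝ) ^ w ≤ ((∏ i, (x i).gcd Q : ℕ) : ℝ) ^ w :=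
          Real.rpow_le_rpow (by positivity) (by exact_mod_cast hg) hw
        calc _ = ((p ^ f * ∏ i, x' i : ℕ) : ℝ) ^ 2 * ((∏ i, (x' i).gcd Q : ℕ) : ℝ) ^ w := by
              push_cast; ring
          _ ≤ _ := mul_le_mul_of_nonneg_left hg' (by positivity)
    · push Not at hfz
      refine ⟨p * Q, Nat.mul_pos hp.pos hQ0, ?_, ?_⟩
      · rw [hprod, Nat.cast_mul, Nat.cast_mul, Real.mul_rpow hp0.le (by positivity), Nat.cast_pow,
          ← Real.rpow_natCast]
        exact mul_le_mul (Real.rpow_le_rpow_of_exponent_le hp1 hfz.le) hQ (by positivity)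
          (by positivity)
      · refine (hstep (e := w * f) fun ν hν => hzw f ν hft hν).trans ?_
        refine (mul_le_mul_of_nonneg_right hZ (by positivity)).trans ?_
        have hg : p ^ f * ∏ i, (x' i).gcd Q ≤ ∏ i, (x i).gcd (p * Q) := by
          rw [hf, ← prod_gcd_prime x hp, ← Finset.prod_mul_distrib]
          refine Finset.prod_le_prod' fun i _ =>
            Nat.le_of_dvd (Nat.gcd_pos_of_pos_right _ (Nat.mul_pos hp.pos hQ0)) ?_
          refine Nat.dvd_gcd ?_ (mul_dvd_mul (Nat.gcd_dvd_right _ _) (Nat.gcd_dvd_right _ _))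
          conv_rhs => rw [hxx' i]
          exact mul_dvd_mul_left _ (Nat.gcd_dvd_left _ _)
        have hg' : ((p ^ f * ∏ i, (x' i).gcd Q : ℕ) : ℝ) ^ w ≤
            ((∏ i, (x i).gcd (p * Q) : ℕ) : ℝ) ^ w :=
          Real.rpow_le_rpow (by positivity) (by exact_mod_cast hg) hw
        have hpw : (p : ℝ) ^ (w * f) = ((p : ℝ) ^ f) ^ w := by
          rw [← Real.rpow_natCast, ← Real.rpow_mul hp0.le, mul_comm]
        rw [hprod]
        calc _ = ((p ^ f * ∏ i, x' i : ℕ) : ℝ) ^ 2 *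
              ((p ^ f * ∏ i, (x' i).gcd Q : ℕ) : ℝ) ^ w := by
              rw [hpw, Nat.cast_mul (p ^ f) (∏ i, (x' i).gcd Q),
                Real.mul_rpow (by positivity) (by positivity)]
              push_cast; ring
          _ ≤ _ := mul_le_mul_of_nonneg_left hg' (by positivity)

/-! ### Few divisors and bounded multiplicity. -/

lemma Nat.exists_card_divisors_le_rpow {κ : ℝ} (hκ : 0 < κ) :
    ∃ C : ℝ, 0 < C ∧ ∀ Q : ℕ, 0 < Q → (Q.divisors.card : ℝ) ≤ C * (Q : ℝ) ^ κ := by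
  have hlog2 : 0 < Real.log 2 := Real.log_pos one_lt_two
  -- `K` is chosen so that `a + 1 ≤ K (1 + aκ log 2) ≤ K p ^ (κa)`, needed only for primes below
  -- `B`; from `B` on, `p ^ κ ≥ 2` and no constant is lost.
  set K : ℝ := 1 + 1 / (κ * Real.log 2) with hK
  have hK1 : 1 ≤ K := by rw [hK]; linarith [show 0 < 1 / (κ * Real.log 2) by positivity]
  set B : ℕ := ⌈(2 : ℝ) ^ (1 / κ)⌉₊ with hB
  refine ⟨K ^ B, by positivity, fun Q hQ => ?_⟩
  have hlocal : ∀ p ∈ Q.primeFactors, ((Q.factorization p + 1 : ℕ) : ℝ) ≤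
      (if p < B then K else 1) * ((p : ℝ) ^ Q.factorization p) ^ κ := by
    intro p hp
    set a := Q.factorization p
    have hp2 : (2 : ℝ) ≤ p := by exact_mod_cast (Nat.prime_of_mem_primeFactors hp).two_le
    have hp0 : (0 : ℝ) < p := by linarith
    have hswap : ((p : ℝ) ^ a) ^ κ = ((p : ℝ) ^ κ) ^ a := by
      rw [← Real.rpow_natCast, ← Real.rpow_mul hp0.le, mul_comm, Real.rpow_mul hp0.le,
        Real.rpow_natCast]
    rw [hswap]
    split_ifs with h
    · have h1 : 1 + κ * Real.log 2 ≤ (p : ℝ) ^ κ := by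
        calc 1 + κ * Real.log 2 ≤ Real.exp (Real.log 2 * κ) := by
              linarith [Real.add_one_le_exp (Real.log 2 * κ)]
          _ = (2 : ℝ) ^ κ := (Real.rpow_def_of_pos two_pos κ).symm
          _ ≤ _ := Real.rpow_le_rpow two_pos.le hp2 hκ.le
      have h2 : 1 + a * (κ * Real.log 2) ≤ ((p : ℝ) ^ κ) ^ a :=
        (one_add_mul_le_pow (by linarith [mul_pos hκ hlog2]) a).trans
          (pow_le_pow_left₀ (by positivity) h1 a)
      refine le_trans ?_ (mul_le_mul_of_nonneg_left h2 (by positivity))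
      have h3 : 1 / (κ * Real.log 2) * (a * (κ * Real.log 2)) = a := by
        field_simp
      rw [hK, Nat.cast_add, Nat.cast_one, add_mul, mul_add (1 / (κ * Real.log 2)), h3]
      have : 0 ≤ (a : ℝ) * (κ * Real.log 2) := by positivity
      have : 0 ≤ 1 / (κ * Real.log 2) := by positivity
      linarith
    · have h1 : (2 : ℝ) ≤ (p : ℝ) ^ κ := by
        have h2 : (2 : ℝ) ^ (1 / κ) ≤ p :=
          (Nat.le_ceil _).trans (by exact_mod_cast not_lt.1 h)
        calc (2 : ℝ) = ((2 : ℝ) ^ (1 / κ)) ^ κ := by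
              rw [← Real.rpow_mul two_pos.le, one_div_mul_cancel hκ.ne', Real.rpow_one]
          _ ≤ _ := Real.rpow_le_rpow (by positivity) h2 hκ.le
      rw [one_mul]
      calc ((a + 1 : ℕ) : ℝ) ≤ (2 : ℝ) ^ a := by exact_mod_cast Nat.lt_two_pow_self
        _ ≤ _ := pow_le_pow_left₀ two_pos.le h1 a
  have hQprod : ∏ p ∈ Q.primeFactors, ((p : ℝ) ^ Q.factorization p) ^ κ = (Q : ℝ) ^ κ := by
    rw [Real.finsetProd_rpow _ _ fun p _ => by positivity]
    congr 1
    conv_rhs => rw [← Nat.prod_factorization_pow_eq_self hQ.ne']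
    rw [Finsupp.prod, Nat.support_factorization]
    push_cast
    rfl
  rw [Nat.card_divisors hQ.ne', Nat.cast_prod]
  refine (Finset.prod_le_prod (fun p _ => by positivity) hlocal).trans ?_
  rw [Finset.prod_mul_distrib, hQprod]
  refine mul_le_mul_of_nonneg_right ?_ (by positivity)
  rw [← Finset.prod_filter, Finset.prod_const]
  refine pow_le_pow_right₀ hK1 ?_
  calc _ ≤ (Finset.range B).card := Finset.card_le_card fun p hp =>
        Finset.mem_range.2 (Finset.mem_filter.1 hp).2
    _ = B := Finset.card_range B

/-- If no integer occurs more than `d` times among the `x i`, then the parts of the `x i` remaining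
after removing common factors with `Q` have a large product. -/
lemma le_log_prod_div_gcd {t : ℕ} {x : Fin t → ℕ} (hx : ∀ i, 0 < x i) {d : ℝ}
    (hd : ∀ m : ℕ, ((Finset.univ.filter fun i => x i = m).card : ℝ) ≤ d) {Q : ℕ} (hQ : 0 < Q)
    {B : ℝ} (hB : 1 ≤ B) :
    (t - B * (d * Q.divisors.card)) * Real.log B ≤
      Real.log ((∏ i, x i / (x i).gcd Q : ℕ) : ℝ) := by
  classical
  set y : Fin t → ℕ := fun i => x i / (x i).gcd Q with hy
  have hypos : ∀ i, 0 < y i := fun i => Nat.div_gcd_pos_of_pos_left _ (hx i)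
  have hd0 : 0 ≤ d := le_trans (Nat.cast_nonneg _) (hd 0)
  -- A value `v` of `y` comes only from orders `g * v` with `g ∣ Q`.
  have hfib : ∀ v : ℕ, ((Finset.univ.filter fun i => y i = v).card : ℝ) ≤
      d * Q.divisors.card := by
    intro v
    have hsub : (Finset.univ.filter fun i => y i = v) ⊆
        Q.divisors.biUnion fun g => Finset.univ.filter fun i => x i = g * v := by
      intro i hi
      simp only [Finset.mem_filter, Finset.mem_univ, true_and] at hi
      simp only [Finset.mem_biUnion, Finset.mem_filter, Finset.mem_univ, true_and]
      refine ⟨(x i).gcd Q, Nat.mem_divisors.2 ⟨Nat.gcd_dvd_right _ _, hQ.ne'⟩, ?_⟩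
      rw [← hi]
      exact (Nat.mul_div_cancel' (Nat.gcd_dvd_left _ _)).symm
    calc ((Finset.univ.filter fun i => y i = v).card : ℝ)
        ≤ ∑ g ∈ Q.divisors, ((Finset.univ.filter fun i => x i = g * v).card : ℝ) := by
          exact_mod_cast (Finset.card_le_card hsub).trans Finset.card_biUnion_le
      _ ≤ ∑ _g ∈ Q.divisors, d := Finset.sum_le_sum fun g _ => hd _
      _ = d * Q.divisors.card := by rw [Finset.sum_const, nsmul_eq_mul, mul_comm]
  set S := Finset.univ.filter fun i => (y i : ℝ) ≤ B with hS
  have hScard : (S.card : ℝ) ≤ B * (d * Q.divisors.card) := by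
    have hmaps : ∀ i ∈ S, y i ∈ Finset.Icc 1 ⌊B⌋₊ := fun i hi =>
      Finset.mem_Icc.2 ⟨hypos i, Nat.le_floor (Finset.mem_filter.1 hi).2⟩
    rw [Finset.card_eq_sum_card_fiberwise hmaps]
    push_cast
    calc _ ≤ ∑ _v ∈ Finset.Icc 1 ⌊B⌋₊, d * (Q.divisors.card : ℝ) :=
          Finset.sum_le_sum fun v _ => le_trans (by
            exact_mod_cast Finset.card_le_card
              (Finset.filter_subset_filter _ (Finset.subset_univ S))) (hfib v)
      _ = ⌊B⌋₊ * (d * Q.divisors.card) := by simp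
      _ ≤ _ := mul_le_mul_of_nonneg_right (Nat.floor_le (by linarith)) (by positivity)
  have hlogB : 0 ≤ Real.log B := Real.log_nonneg hB
  have hcompl : ((Sᶜ).card : ℝ) = t - S.card := by
    rw [Finset.card_compl, Nat.cast_sub (Finset.card_le_univ S), Fintype.card_fin]
  rw [Nat.cast_prod, Real.log_prod fun i _ => by exact_mod_cast (hypos i).ne']
  calc (t - B * (d * Q.divisors.card)) * Real.log B
      ≤ (Sᶜ).card * Real.log B := by
        rw [hcompl]; exact mul_le_mul_of_nonneg_right (by linarith) hlogB
    _ = ∑ _i ∈ Sᶜ, Real.log B := by rw [Finset.sum_const, nsmul_eq_mul]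
    _ ≤ ∑ i ∈ Sᶜ, Real.log (y i) := Finset.sum_le_sum fun i hi => by
        refine Real.log_le_log (by linarith) ?_
        simp only [hS, Finset.mem_compl, Finset.mem_filter, Finset.mem_univ, true_and,
          not_le] at hi
        exact hi.le
    _ ≤ ∑ i, Real.log (y i) :=
        Finset.sum_le_sum_of_subset_of_nonneg (Finset.subset_univ _) fun i _ _ =>
          Real.log_nonneg (by exact_mod_cast hypos i)

/-! ### The extremal constant and the final optimization. -/

lemma gammaConst_pos {R : ℝ} (hR : 0 < R) : 0 < gammaConst R := by
  have h : R < Real.sqrt (R * (R + 1)) := Real.lt_sqrt_of_sq_lt (by nlinarith)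
  have h' : 0 < Real.sqrt (R * (R + 1)) - R := sub_pos.2 h
  unfold gammaConst
  positivity

/-- `4Rγ = 2R + 1 - 2√(R(R+1))` is the maximum of `u(1 - u) / (u + R)` over `u ≥ 0`, attained at `u
= √(R(R+1)) - R`. With `u = ν / f` the defect is a perfect square; then `f` is enlarged to `t`. -/
lemma mul_sub_le_gammaConst {R : ℝ} (hR : 0 < R) {t f ν : ℝ} (hft : f ≤ t) (hf : 0 ≤ f)
    (hν : 0 ≤ ν) :
    ν * (f - ν) ≤ 4 * R * gammaConst R * t * ν + 4 * R * gammaConst R * t * R * f := by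
  have hγ : 0 < gammaConst R := gammaConst_pos hR
  set s := Real.sqrt (R * (R + 1)) with hs
  have hs2 : s ^ 2 = R * (R + 1) := Real.sq_sqrt (by positivity)
  have hc : 4 * R * gammaConst R = 2 * R + 1 - 2 * s := by
    unfold gammaConst
    rw [← hs]
    field_simp
    nlinarith
  have hc0 : 0 ≤ 4 * R * gammaConst R := by positivity
  have key : ν * (f - ν) ≤ 4 * R * gammaConst R * f * (ν + R * f) := by
    have hsq : 4 * R * gammaConst R * f * (ν + R * f) - ν * (f - ν) = (ν - (s - R) * f) ^ 2 := by
      rw [hc]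
      linear_combination (-f ^ 2) * hs2
    nlinarith [sq_nonneg (ν - (s - R) * f)]
  have : 4 * R * gammaConst R * f * (ν + R * f) ≤ 4 * R * gammaConst R * t * (ν + R * f) := by
    gcongr
  linarith

open Filter in
lemma eventually_log_log_le_mul_rpow {δ s : ℝ} (hδ : 0 < δ) (hs : 0 < s) :
    ∀ᶠ n : ℕ in atTop, Real.log (Real.log n) ≤ δ * Real.log n ^ s := by
  have hL : Tendsto (fun n : ℕ => Real.log n) atTop atTop :=
    Real.tendsto_log_atTop.comp tendsto_natCast_atTop_atTop
  filter_upwards [hL.eventually ((isLittleO_log_rpow_atTop hs).bound hδ),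
    hL.eventually_ge_atTop 1] with n hn hn1
  rw [Real.norm_of_nonneg (Real.log_nonneg hn1), Real.norm_of_nonneg (by positivity)] at hn
  exact hn

/-- The count of subgroups in logarithmic form, before optimizing over the size of the part of the
orders coprime to `Q`. -/
lemma exists_log_subgroupCount_le {R : ℝ} (hR : 0 < R) {t : ℕ} {x : Fin t → ℕ}
    (hx : ∀ i, 0 < x i) {n r : ℕ} (hr : 0 < r)
    (hn : (r : ℝ) * (Nat.card (CyclicProduct x) : ℝ) ^ R ≤ n) :
    ∃ Q : ℕ, 0 < Q ∧ 4 * R * gammaConst R * t * (R * Real.log Q) ≤ Real.log n ∧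
      (subgroupCount (CyclicProduct x) r : ℝ) ≤
        Real.exp (4 * R * gammaConst R * t *
          (Real.log n - R * Real.log ((∏ i, x i / (x i).gcd Q : ℕ) : ℝ)) +
            2 / R * Real.log n) := by
  have hγ := gammaConst_pos hR
  set z := 4 * R * gammaConst R * t with hz
  have hz0 : 0 ≤ z := by positivity
  have := finite_cyclicProduct hx
  obtain ⟨Q, hQ0, hQ, hZ⟩ := exists_subgroupZeta_cyclicProduct_le (z := z) (w := z * R)
    (by positivity)
    (fun f ν hf _ => mul_sub_le_gammaConst hR (by exact_mod_cast hf) (by positivity)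
      (by positivity)) x hx
  rw [card_cyclicProduct] at hn
  set a : ℝ := ((∏ i, x i : ℕ) : ℝ) with ha
  set D : ℝ := ((∏ i, (x i).gcd Q : ℕ) : ℝ) with hD
  set Y : ℝ := ((∏ i, x i / (x i).gcd Q : ℕ) : ℝ) with hY
  have ha1 : 1 ≤ a := Nat.one_le_cast.2 (Nat.succ_le_of_lt
    (Finset.prod_pos fun i _ => hx i))
  have hD1 : 1 ≤ D := Nat.one_le_cast.2 (Nat.succ_le_of_lt
    (Finset.prod_pos fun i _ => Nat.gcd_pos_of_pos_right (x i) hQ0))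
  have hY1 : 1 ≤ Y := Nat.one_le_cast.2 (Nat.succ_le_of_lt
    (Finset.prod_pos fun i _ => Nat.div_gcd_pos_of_pos_left Q (hx i)))
  have hr1 : (1 : ℝ) ≤ r := by exact_mod_cast hr
  have hQ1 : (1 : ℝ) ≤ Q := by exact_mod_cast hQ0
  have haDY : a = D * Y := by
    rw [ha, hD, hY, ← Nat.cast_mul, ← Finset.prod_mul_distrib]
    congr 1
    exact Finset.prod_congr rfl fun i _ => (Nat.mul_div_cancel' (Nat.gcd_dvd_left _ _)).symm
  have hlogn : Real.log r + R * Real.log a ≤ Real.log n := by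
    have h := Real.log_le_log (by positivity) hn
    rwa [Real.log_mul (by positivity) (by positivity), Real.log_rpow (by positivity)] at h
  have hlogr : 0 ≤ Real.log r := Real.log_nonneg hr1
  have hloga : Real.log a = Real.log D + Real.log Y := by
    rw [haDY, Real.log_mul (by positivity) (by positivity)]
  refine ⟨Q, hQ0, ?_, ?_⟩
  · have h := Real.log_le_log (by positivity) hQ
    rw [Real.log_rpow (by positivity)] at h
    nlinarith
  · have hcount := (subgroupCount_le_rpow_mul_subgroupZeta (CyclicProduct x) hz0 r).trans
      (mul_le_mul_of_nonneg_left hZ (by positivity))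
    refine hcount.trans ?_
    rw [← Real.log_le_iff_le_exp (by positivity), Real.log_mul (by positivity) (by positivity),
      Real.log_mul (by positivity) (by positivity), Real.log_rpow (by positivity),
      Real.log_rpow (by positivity), Real.log_pow]
    have h1 : z * (Real.log r + R * Real.log a) ≤ z * Real.log n :=
      mul_le_mul_of_nonneg_left hlogn hz0
    have h2 : 2 * Real.log a ≤ 2 / R * Real.log n := by
      rw [div_mul_eq_mul_div, le_div_iff₀ hR]
      linarith
    rw [hloga] at h1
    rw [Nat.cast_ofNat]
    linarith

theorem theorem6 (d R : ℝ) (hd : 0 < d) (hR : 0 < R) :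
    ∀ ε : ℝ, 0 < ε → ∃ N : ℕ, ∀ n r : ℕ, N ≤ n → N ≤ r → 0 < n → 0 < r →
      ∀ (t : ℕ) (x : Fin t → ℕ), (∀ i, 0 < x i) →
        (∀ m : ℕ, ((Finset.univ.filter (fun i => x i = m)).card : ℝ) ≤ d) →
        (r : ℝ) * (Nat.card (CyclicProduct x) : ℝ) ^ R ≤ (n : ℝ) →
        (subgroupCount (CyclicProduct x) r : ℝ) ≤
          (n : ℝ) ^ ((gammaConst R + ε) * (Real.log n / Real.log (Real.log n))) := by
  intro ε hε
  have hγ := gammaConst_pos hR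
  set γ := gammaConst R with hγdef
  -- This `η` makes the later loss of a factor `(1 - η) ^ 2` affordable within `ε / 2`.
  set η : ℝ := (ε / 4) / (γ + ε / 2) with hη
  have hη0 : 0 < η := by positivity
  have hη1 : η < 1 / 2 := by
    rw [hη, div_lt_iff₀ (by positivity)]; linarith
  have hβ : γ ≤ (γ + ε / 2) * (1 - η) ^ 2 := by
    have h1 : (γ + ε / 2) * η = ε / 4 := by rw [hη]; field_simp
    nlinarith [mul_pos (show 0 < γ + ε / 2 by positivity) (pow_pos hη0 2)]
  obtain ⟨C, hC0, hC⟩ := Nat.exists_card_divisors_le_rpow (κ := η / 2 * (R * γ)) (by positivity)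
  have hev := ((eventually_log_log_le_mul_rpow (δ := ε * R / 4) (s := 1) (by positivity)
    one_pos).and (eventually_log_log_le_mul_rpow (δ := η / (4 * R * d * C)) (s := η / 2)
    (by positivity) (by positivity))).and
    ((Real.tendsto_log_atTop.comp tendsto_natCast_atTop_atTop).eventually_ge_atTop (Real.exp 1))
  obtain ⟨N, hN⟩ := Filter.eventually_atTop.1 hev
  refine ⟨N, fun n r hn _ hn0 hr0 t x hx hmult hle => ?_⟩
  obtain ⟨⟨hev1, hev2⟩, hev3⟩ := hN n hn
  obtain ⟨Q, hQ0, hQ, hcount⟩ := exists_log_subgroupCount_le hR hx hr0 hle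
  rw [← hγdef] at hQ hcount
  set L := Real.log n with hL
  set l := Real.log L with hl
  have hLe : Real.exp 1 ≤ L := hev3
  have hL1 : 1 < L := lt_of_lt_of_le (by linarith [Real.add_one_le_exp 1]) hLe
  have hL0 : 0 < L := by linarith
  have hl1 : 1 ≤ l := by
    have := Real.log_le_log (Real.exp_pos 1) hLe
    rwa [Real.log_exp] at this
  have hl0 : 0 < l := by linarith
  set lY := Real.log ((∏ i, x i / (x i).gcd Q : ℕ) : ℝ) with hlY
  have hlY0 : 0 ≤ lY := Real.log_natCast_nonneg _
  refine hcount.trans ?_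
  rw [Real.rpow_def_of_pos (by exact_mod_cast hn0), Real.exp_le_exp, ← hL]
  have herr : 2 / R * L ≤ ε / 2 * (L ^ 2 / l) := by
    rw [Real.rpow_one] at hev1
    rw [div_mul_eq_mul_div, div_mul_div_comm, div_le_div_iff₀ hR (by positivity)]
    nlinarith
  have hgoal : L * ((γ + ε) * (L / l)) = (γ + ε / 2) * (L ^ 2 / l) + ε / 2 * (L ^ 2 / l) := by
    ring
  rw [hgoal]
  refine add_le_add ?_ herr
  have ht0 : (0 : ℝ) ≤ t := Nat.cast_nonneg t
  rw [← mul_div_assoc, le_div_iff₀ hl0]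
  -- For small `t` the bound `4Rγt L` suffices even with `lY = 0`. Large `t` is what makes `Q ^ z ≤
  -- |A|` restrict `Q`.
  by_cases ht : (t : ℝ) * (4 * R * l) ≤ L
  · calc 4 * R * γ * t * (L - R * lY) * l ≤ 4 * R * γ * t * L * l := by
          gcongr; linarith [mul_nonneg hR.le hlY0]
      _ = γ * L * (t * (4 * R * l)) := by ring
      _ ≤ γ * L * L := by gcongr
      _ ≤ (γ + ε / 2) * L ^ 2 := by nlinarith [sq_nonneg L]
  · push Not at ht
    have htpos : (0 : ℝ) < t := by
      rcases ht0.lt_or_eq with h | h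
      · exact h
      · rw [← h, zero_mul] at ht; linarith
    have hlogQ : Real.log Q * (R * γ) ≤ l := by
      have h0 : 0 ≤ Real.log Q := Real.log_natCast_nonneg _
      have h1 : γ * L * (R * Real.log Q) ≤ l * L := by
        calc γ * L * (R * Real.log Q) ≤ γ * (t * (4 * R * l)) * (R * Real.log Q) := by gcongr
          _ = l * (4 * R * γ * t * (R * Real.log Q)) := by ring
          _ ≤ l * L := by gcongr
      exact le_of_mul_le_mul_right (by linarith) hL0
    have hdiv : (Q.divisors.card : ℝ) ≤ C * L ^ (η / 2) := by
      refine (hC Q hQ0).trans (mul_le_mul_of_nonneg_left ?_ hC0.le)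
      rw [Real.rpow_def_of_pos (by exact_mod_cast hQ0), Real.rpow_def_of_pos hL0,
        Real.exp_le_exp, ← hl]
      calc Real.log Q * (η / 2 * (R * γ)) = η / 2 * (Real.log Q * (R * γ)) := by ring
        _ ≤ η / 2 * l := mul_le_mul_of_nonneg_left hlogQ (by positivity)
        _ = l * (η / 2) := mul_comm _ _
    have hB1 : 1 ≤ L ^ (1 - η) := Real.one_le_rpow hL1.le (by linarith)
    -- Indices with `x_i / (x_i, Q) ≤ L ^ (1 - η)` number at most `L ^ (1 - η / 2)` up to a
    -- constant, against `t ≥ L / (4Rl)`; the spare `L ^ (η / 2)` beats `l`.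
    have hfew : L ^ (1 - η) * (d * Q.divisors.card) ≤ η * t := by
      have h1 : L ^ (1 - η) * L ^ (η / 2) * L ^ (η / 2) = L := by
        rw [← Real.rpow_add hL0, ← Real.rpow_add hL0]
        convert Real.rpow_one L using 2
        ring
      have h2 : 4 * R * d * C * l ≤ η * L ^ (η / 2) := by
        rwa [div_mul_eq_mul_div, le_div_iff₀ (by positivity), mul_comm] at hev2
      have h3 : L ^ (1 - η) * (d * (C * L ^ (η / 2))) ≤ η * t := by
        refine le_of_mul_le_mul_right ?_ (show 0 < 4 * R * l by positivity)
        calc L ^ (1 - η) * (d * (C * L ^ (η / 2))) * (4 * R * l)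
            = L ^ (1 - η) * L ^ (η / 2) * (4 * R * d * C * l) := by ring
          _ ≤ L ^ (1 - η) * L ^ (η / 2) * (η * L ^ (η / 2)) := by gcongr
          _ = η * (L ^ (1 - η) * L ^ (η / 2) * L ^ (η / 2)) := by ring
          _ = η * L := by rw [h1]
          _ ≤ η * (t * (4 * R * l)) := by gcongr
          _ = η * t * (4 * R * l) := by ring
      exact le_trans (by gcongr) h3
    have hY : (1 - η) ^ 2 * t * l ≤ lY := by
      have h := le_log_prod_div_gcd hx hmult hQ0 hB1
      rw [Real.log_rpow hL0, ← hl] at h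
      have h1 : (t - η * t) * ((1 - η) * l) ≤
          (t - L ^ (1 - η) * (d * Q.divisors.card)) * ((1 - η) * l) :=
        mul_le_mul_of_nonneg_right (by linarith) (mul_nonneg (by linarith) hl0.le)
      calc (1 - η) ^ 2 * t * l = (t - η * t) * ((1 - η) * l) := by ring
        _ ≤ lY := h1.trans h
    set β := (1 - η) ^ 2 with hβdef
    have hβ0 : 0 < β := pow_pos (by linarith) 2
    -- AM-GM, with equality at `Rβtl = L / 2`.
    have hamgm : 4 * R * β * t * l * (L - R * (β * t * l)) ≤ L ^ 2 := by
      have h : L ^ 2 - 4 * R * β * t * l * (L - R * (β * t * l)) =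
          (L - 2 * R * β * t * l) ^ 2 := by ring
      linarith [sq_nonneg (L - 2 * R * β * t * l)]
    refine le_of_mul_le_mul_right ?_ hβ0
    calc 4 * R * γ * t * (L - R * lY) * l * β ≤
          4 * R * γ * t * (L - R * (β * t * l)) * l * β := by gcongr
      _ = γ * (4 * R * β * t * l * (L - R * (β * t * l))) := by ring
      _ ≤ γ * L ^ 2 := by gcongr
      _ ≤ (γ + ε / 2) * β * L ^ 2 := by gcongr
      _ = (γ + ε / 2) * L ^ 2 * β := by ring
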